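/- Let $M=\{z\in\mathbb{C}: |z|\ge 1\}\cup\{0\}$, a commutative monoid with zero under multiplication of complex numbers, and let $\mathfrak{H}_M=\mathbb{Q}\langle e_z\mid z\in M\rangle$ be the non-commutative polynomial ring on symbols $e_z$ ($z\in M$). Let $\mathfrak{H}_{M,*}$ be the $\mathbb{Q}$-vector space $\mathfrak{H}_M$ equipped with the harmonic product $*$, i.e. the $\mathbb{Q}$-bilinear product determined by $1*w=w*1=w$ and $$e_a w * e_b w' = e_{ab}\bigl(w*e_b w' + e_a w*w' - e_0(w*w')\bigr)\qquad (a,b\in M,\ w,w'\in\mathfrak{H}_M),$$ where juxtaposition is the usual product of $\mathfrak{H}_M$; this product is commutative and associative. Put $$\mathfrak{H}_M^0=\mathbb{Q}\oplus\bigoplus_{a\in M\setminus\{0,1\}}\mathbb{Q}e_a\oplus\bigoplus_{a\in M\setminus\{0\},\ b\in M\setminus\{1\}}e_a\mathfrak{H}_M e_b ,$$ i.e. the span of the words $e_{z_1}\cdots e_{z_k}$ ($k\ge 0$) that are empty or satisfy $z_1\ne 0$ and $z_k\ne 1$. It is closed under $*$, and $\mathfrak{H}^0_{M,*}$ denotes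 the resulting $\mathbb{Q}$-subalgebra of $\mathfrak{H}_{M,*}$. Then for every word $e_{z_1}\cdots e_{z_k}$ in $\mathfrak{H}_M^0$ the integral $$I_{0,1}(e_{z_1}\cdots e_{z_k})=\int_{0<t_1<\cdots<t_k<1}\prod_{i=1}^k\frac{dt_i}{t_i-z_i}$$ converges absolutely (it is understood as $1$ for $k=0$), and its $\mathbb{Q}$-linear extension $I_{0,1}\colon\mathfrak{H}^0_{M,*}\to\mathbb{C}$ is a homomorphism of $\mathbb{Q}$-algebras. -/

import Mathlib

open MeasureTheory

namespace HarmonicProduct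

noncomputable section

section General

/-- The monomial `e_{z_1} ⋯ e_{z_k}` of the non-commutative polynomial ring
`ℚ⟨e_z | z ∈ M⟩ = FreeAlgebra ℚ M`, where `e_z = FreeAlgebra.ι ℚ z`. -/
def word {M : Type*} (w : List M) : FreeAlgebra ℚ M :=
  (w.map (FreeAlgebra.ι ℚ)).prod

theorem basis_eq_word {M : Type*} (w : FreeMonoid M) :
    FreeAlgebra.basisFreeMonoid ℚ M w = word w.toList := by
  simp only [FreeAlgebra.basisFreeMonoid, Module.Basis.map_apply]
  simp [word, FreeAlgebra.equivMonoidAlgebraFreeMonoid, FreeMonoid.lift_apply]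

/-- The monomials form a `ℚ`-basis of the non-commutative polynomial ring. -/
def wordBasis (M : Type*) : Module.Basis (List M) ℚ (FreeAlgebra ℚ M) :=
  (FreeAlgebra.basisFreeMonoid ℚ M).reindex FreeMonoid.toList

@[simp] theorem wordBasis_apply {M : Type*} (w : List M) : wordBasis M w = word w := by
  simp [wordBasis, basis_eq_word]

@[simp] theorem word_nil {M : Type*} : word ([] : List M) = 1 := by simp [word]

theorem word_cons {M : Type*} (a : M) (w : List M) :
    word (a :: w) = FreeAlgebra.ι ℚ a * word w := by simp [word]

/-- The harmonic product of two monomials: `1 ∗ w = w ∗ 1 = w` and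
`e_a w ∗ e_b w' = e_{ab} (w ∗ e_b w' + e_a w ∗ w' - e_0 (w ∗ w'))`. -/
def wordMul {M : Type*} [CommMonoidWithZero M] : List M → List M → FreeAlgebra ℚ M
  | [], v => word v
  | a :: u, [] => word (a :: u)
  | a :: u, b :: v =>
      FreeAlgebra.ι ℚ (a * b) *
        (wordMul u (b :: v) + wordMul (a :: u) v - FreeAlgebra.ι ℚ 0 * wordMul u v)
termination_by u v => u.length + v.length

/-- The harmonic product `∗` on `ℚ⟨e_z | z ∈ M⟩`, extended `ℚ`-bilinearly from monomials. -/
def harmonicMul (M : Type*) [CommMonoidWithZero M] :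
    FreeAlgebra ℚ M →ₗ[ℚ] FreeAlgebra ℚ M →ₗ[ℚ] FreeAlgebra ℚ M :=
  (wordBasis M).constr ℚ fun u => (wordBasis M).constr ℚ fun v => wordMul u v

@[elab_as_elim] theorem word_induction {M : Type*} {p : FreeAlgebra ℚ M → Prop} (x : FreeAlgebra ℚ M)
    (hw : ∀ w, p (word w)) (hadd : ∀ x y, p x → p y → p (x + y))
    (hsmul : ∀ (c : ℚ) x, p x → p (c • x)) : p x := by
  have hx := (wordBasis M).mem_span x
  induction hx using Submodule.span_induction with
  | mem x h => obtain ⟨w, rfl⟩ := h; simpa using hw w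
  | zero => simpa using hsmul 0 _ (hw [])
  | add x y _ _ h1 h2 => exact hadd x y h1 h2
  | smul c x _ h => exact hsmul c x h

variable {M : Type*} [CommMonoidWithZero M]

theorem harmonicMul_word (u v : List M) : harmonicMul M (word u) (word v) = wordMul u v := by
  rw [← wordBasis_apply u, ← wordBasis_apply v]
  simp only [harmonicMul, Module.Basis.constr_basis]

theorem one_harmonicMul (x : FreeAlgebra ℚ M) : harmonicMul M 1 x = x := by
  induction x using word_induction with
  | hw w => rw [← word_nil, harmonicMul_word, wordMul]
  | hadd x y h1 h2 => rw [map_add, h1, h2]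
  | hsmul c x h => rw [map_smul, h]

theorem wordMul_comm (u v : List M) : wordMul u v = wordMul v u := by
  induction u, v using wordMul.induct with
  | case1 v => cases v <;> simp [wordMul]
  | case2 a u => simp [wordMul]
  | case3 a u b v h1 h2 h3 =>
    rw [wordMul, wordMul, h1, h2, h3, mul_comm a b]
    congr 2
    abel

theorem harmonicMul_comm (x y : FreeAlgebra ℚ M) : harmonicMul M x y = harmonicMul M y x := by
  induction x using word_induction with
  | hadd x y h1 h2 => simp [h1, h2]
  | hsmul c x h => simp [h]
  | hw u =>
    induction y using word_induction with
    | hadd x y h1 h2 => simp [h1, h2]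
    | hsmul c x h => simp [h]
    | hw v => rw [harmonicMul_word, harmonicMul_word, wordMul_comm]

theorem harmonicMul_ι_mul (a b : M) (x y : FreeAlgebra ℚ M) :
    harmonicMul M (FreeAlgebra.ι ℚ a * x) (FreeAlgebra.ι ℚ b * y) =
      FreeAlgebra.ι ℚ (a * b) * (harmonicMul M x (FreeAlgebra.ι ℚ b * y) +
        harmonicMul M (FreeAlgebra.ι ℚ a * x) y - FreeAlgebra.ι ℚ 0 * harmonicMul M x y) := by
  induction x using word_induction with
  | hadd x z h1 h2 =>
    simp only [mul_add, map_add, LinearMap.add_apply, h1, h2, mul_sub]; abel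
  | hsmul c x h =>
    simp only [mul_smul_comm, map_smul, LinearMap.smul_apply, h, ← smul_add, ← smul_sub]
  | hw u =>
    induction y using word_induction with
    | hadd x z h1 h2 =>
      simp only [mul_add, map_add, h1, h2, mul_sub]; abel
    | hsmul c x h =>
      simp only [mul_smul_comm, map_smul, h, ← smul_add, ← smul_sub]
    | hw v =>
      simp only [← word_cons, harmonicMul_word]
      rw [wordMul]

theorem ι_zero_mul_harmonicMul (x y : FreeAlgebra ℚ M) :
    harmonicMul M (FreeAlgebra.ι ℚ 0 * x) y = FreeAlgebra.ι ℚ 0 * harmonicMul M x y := by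
  induction y using word_induction with
  | hadd x z h1 h2 => simp only [mul_add, map_add, h1, h2]
  | hsmul c x h => simp only [mul_smul_comm, map_smul, h]
  | hw v =>
    induction v with
    | nil =>
      rw [word_nil, harmonicMul_comm, one_harmonicMul, harmonicMul_comm, one_harmonicMul]
    | cons b v ih => rw [word_cons, harmonicMul_ι_mul, ih, zero_mul]; simp

theorem harmonicMul_ι_zero_mul (x y : FreeAlgebra ℚ M) :
    harmonicMul M x (FreeAlgebra.ι ℚ 0 * y) = FreeAlgebra.ι ℚ 0 * harmonicMul M x y := by
  rw [harmonicMul_comm, ι_zero_mul_harmonicMul, harmonicMul_comm]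

theorem harmonicMul_assoc_word (n : ℕ) (u v w : List M)
    (hn : u.length + v.length + w.length = n) :
    harmonicMul M (harmonicMul M (word u) (word v)) (word w) =
      harmonicMul M (word u) (harmonicMul M (word v) (word w)) := by
  induction n using Nat.strong_induction_on generalizing u v w with
  | _ n ih =>
  rcases u with - | ⟨a, u⟩
  · simp [one_harmonicMul]
  rcases v with - | ⟨b, v⟩
  · rw [word_nil, one_harmonicMul, harmonicMul_comm _ 1, one_harmonicMul]
  rcases w with - | ⟨c, w⟩
  · rw [word_nil, harmonicMul_comm _ 1, one_harmonicMul, harmonicMul_comm _ 1, one_harmonicMul]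
  simp only [List.length_cons] at hn
  have e1 := ih _ (by simp only [List.length_cons]; omega) u (b :: v) (c :: w) rfl
  have e2 := ih _ (by simp only [List.length_cons]; omega) (a :: u) v (c :: w) rfl
  have e3 := ih _ (by simp only [List.length_cons]; omega) (a :: u) (b :: v) w rfl
  have e4 := ih _ (by simp only [List.length_cons]; omega) u v (c :: w) rfl
  have e5 := ih _ (by simp only [List.length_cons]; omega) u (b :: v) w rfl
  have e6 := ih _ (by simp only [List.length_cons]; omega) (a :: u) v w rfl
  have e7 := ih _ (by omega) u v w rfl
  have h12 := harmonicMul_ι_mul a b (word u) (word v)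
  have h23 := harmonicMul_ι_mul b c (word v) (word w)
  simp only [word_cons] at e1 e2 e3 e4 e5 e6 ⊢
  rw [h12, h23, harmonicMul_ι_mul, harmonicMul_ι_mul, ← h12, ← h23, mul_assoc a b c]
  simp only [map_add, map_sub, LinearMap.add_apply, LinearMap.sub_apply,
    ι_zero_mul_harmonicMul, harmonicMul_ι_zero_mul, e1, e2, e3, e4, e5, e6, e7, mul_add, mul_sub]
  abel

theorem harmonicMul_assoc (x y z : FreeAlgebra ℚ M) :
    harmonicMul M (harmonicMul M x y) z = harmonicMul M x (harmonicMul M y z) := by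
  induction x using word_induction with
  | hadd x y h1 h2 => simp [h1, h2]
  | hsmul c x h => simp [h]
  | hw u =>
    induction y using word_induction with
    | hadd x y h1 h2 => simp [h1, h2]
    | hsmul c x h => simp [h]
    | hw v =>
      induction z using word_induction with
      | hadd x y h1 h2 => simp [h1, h2]
      | hsmul c x h => simp [h]
      | hw w => exact harmonicMul_assoc_word _ u v w rfl

end General

/-- The harmonic algebra: the `ℚ`-vector space `ℚ⟨e_z | z ∈ M⟩` with the harmonic product as
its multiplication. -/
def HarmonicAlgebra (M : Type*) : Type _ := FreeAlgebra ℚ M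

instance (M : Type*) : AddCommGroup (HarmonicAlgebra M) :=
  inferInstanceAs (AddCommGroup (FreeAlgebra ℚ M))

instance (M : Type*) : Module ℚ (HarmonicAlgebra M) :=
  inferInstanceAs (Module ℚ (FreeAlgebra ℚ M))

/-- The identity map from the polynomial ring to the harmonic algebra. -/
def toHarmonic (M : Type*) : FreeAlgebra ℚ M ≃ₗ[ℚ] HarmonicAlgebra M :=
  LinearEquiv.refl ℚ (FreeAlgebra ℚ M)

instance (M : Type*) [CommMonoidWithZero M] : CommRing (HarmonicAlgebra M) where
  __ := (inferInstance : AddCommGroup (HarmonicAlgebra M))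
  one := toHarmonic M 1
  mul x y := toHarmonic M (harmonicMul M ((toHarmonic M).symm x) ((toHarmonic M).symm y))
  left_distrib x y z := (harmonicMul M x).map_add y z
  right_distrib x y z := (harmonicMul M).map_add₂ x y z
  zero_mul x := (harmonicMul M).map_zero₂ x
  mul_zero x := (harmonicMul M x).map_zero
  mul_assoc := harmonicMul_assoc (M := M)
  one_mul := one_harmonicMul (M := M)
  mul_one x := (harmonicMul_comm (M := M) x 1).trans (one_harmonicMul (M := M) x)
  mul_comm := harmonicMul_comm (M := M)

instance (M : Type*) [CommMonoidWithZero M] : Algebra ℚ (HarmonicAlgebra M) :=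
  Algebra.ofModule
    (fun c x y => (harmonicMul M).map_smul₂ c x y) (fun c x y => (harmonicMul M x).map_smul c y)

theorem toHarmonic_one (M : Type*) [CommMonoidWithZero M] : toHarmonic M 1 = 1 := rfl

theorem toHarmonic_mul {M : Type*} [CommMonoidWithZero M] (x y : FreeAlgebra ℚ M) :
    toHarmonic M x * toHarmonic M y = toHarmonic M (harmonicMul M x y) := rfl

/-- The monoid `{z ∈ ℂ : |z| ≥ 1} ∪ {0}` under multiplication of complex numbers. -/
def outerMonoid : Submonoid ℂ where
  carrier := {z | 1 ≤ ‖z‖} ∪ {0}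
  one_mem' := by simp
  mul_mem' := by
    rintro a b (ha | ha) (hb | hb)
    · left
      simp only [Set.mem_ofPred_eq, norm_mul] at *
      nlinarith
    all_goals right; simp_all

instance : CommMonoidWithZero outerMonoid where
  __ := (inferInstance : CommMonoid outerMonoid)
  zero := ⟨0, Or.inr rfl⟩
  zero_mul a := Subtype.ext (zero_mul (a : ℂ))
  mul_zero a := Subtype.ext (mul_zero (a : ℂ))

theorem coe_zero : ((0 : outerMonoid) : ℂ) = 0 := rfl

theorem outerMonoid_zero_ne_one : (0 : outerMonoid) ≠ 1 := fun h =>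
  zero_ne_one (α := ℂ) (congrArg Subtype.val h)

theorem outerMonoid_mul_ne_zero {a b : outerMonoid} (ha : a ≠ 0) (hb : b ≠ 0) : a * b ≠ 0 :=
  fun h => (mul_eq_zero.mp (congrArg Subtype.val h : (a : ℂ) * b = 0)).elim
    (fun h => ha (Subtype.ext h)) (fun h => hb (Subtype.ext h))

/-- A word is admissible if it is empty, or its first letter is not `0` and its last letter is
not `1`. -/
def IsAdmissible (w : List outerMonoid) : Prop :=
  w.head? ≠ some 0 ∧ w.getLast? ≠ some 1

/-- The subspace spanned by the admissible words, i.e.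
`ℚ ⊕ ⨁_{a ≠ 0, 1} ℚ e_a ⊕ ⨁_{a ≠ 0, b ≠ 1} e_a ℚ⟨e_z | z ∈ M⟩ e_b`. -/
def admissibleSubmodule : Submodule ℚ (FreeAlgebra ℚ outerMonoid) :=
  Submodule.span ℚ (word '' {w | IsAdmissible w})

/-- The span of the nonempty words whose last letter is not `1`. -/
def endSubmodule : Submodule ℚ (FreeAlgebra ℚ outerMonoid) :=
  Submodule.span ℚ (word '' {w | w ≠ [] ∧ w.getLast? ≠ some 1})

theorem ι_mul_mem_end (a : outerMonoid) {x : FreeAlgebra ℚ outerMonoid} (hx : x ∈ endSubmodule) :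
    FreeAlgebra.ι ℚ a * x ∈ endSubmodule := by
  refine Submodule.span_le
    (p := endSubmodule.comap (LinearMap.mulLeft ℚ (FreeAlgebra.ι ℚ a))) |>.mpr ?_ hx
  rintro _ ⟨w, ⟨h1, h2⟩, rfl⟩
  refine Submodule.subset_span ⟨a :: w, ⟨by simp, ?_⟩, word_cons a w⟩
  cases w with
  | nil => exact absurd rfl h1
  | cons b w => simpa using h2

theorem ι_mul_mem_admissible {a : outerMonoid} (ha : a ≠ 0) {x : FreeAlgebra ℚ outerMonoid}
    (hx : x ∈ endSubmodule) : FreeAlgebra.ι ℚ a * x ∈ admissibleSubmodule := by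
  refine Submodule.span_le
    (p := admissibleSubmodule.comap (LinearMap.mulLeft ℚ (FreeAlgebra.ι ℚ a))) |>.mpr ?_ hx
  rintro _ ⟨w, ⟨h1, h2⟩, rfl⟩
  refine Submodule.subset_span ⟨a :: w, ⟨by simpa using ha, ?_⟩, word_cons a w⟩
  cases w with
  | nil => exact absurd rfl h1
  | cons b w => simpa using h2

theorem getLast?_tail_ne {a : outerMonoid} {u : List outerMonoid}
    (h : (a :: u).getLast? ≠ some 1) : u.getLast? ≠ some 1 := by
  cases u with
  | nil => simp
  | cons b u => simpa using h

theorem wordMul_inner_mem_end (a b : outerMonoid) (u v : List outerMonoid)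
    (hu : (a :: u).getLast? ≠ some 1) (hv : (b :: v).getLast? ≠ some 1)
    (H : ∀ u' v' : List outerMonoid, u'.length + v'.length < (a :: u).length + (b :: v).length →
      u'.getLast? ≠ some 1 → v'.getLast? ≠ some 1 → (u' ≠ [] ∨ v' ≠ []) →
      wordMul u' v' ∈ endSubmodule) :
    wordMul u (b :: v) + wordMul (a :: u) v - FreeAlgebra.ι ℚ 0 * wordMul u v ∈ endSubmodule := by
  have hu' := getLast?_tail_ne hu
  have hv' := getLast?_tail_ne hv
  refine sub_mem (add_mem (H _ _ (by simp) hu' hv (by simp))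
    (H _ _ (by simp) hu hv' (by simp))) ?_
  by_cases h : u ≠ [] ∨ v ≠ []
  · exact ι_mul_mem_end 0 (H _ _ (by simp only [List.length_cons]; omega) hu' hv' h)
  · simp only [ne_eq, not_or, not_not] at h
    obtain ⟨rfl, rfl⟩ := h
    refine Submodule.subset_span ⟨[0], ⟨by simp, ?_⟩, ?_⟩
    · simpa using outerMonoid_zero_ne_one
    · simp [wordMul, word]

theorem wordMul_mem_end (n : ℕ) (u v : List outerMonoid) (hn : u.length + v.length = n)
    (hu : u.getLast? ≠ some 1) (hv : v.getLast? ≠ some 1) (h : u ≠ [] ∨ v ≠ []) :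
    wordMul u v ∈ endSubmodule := by
  induction n using Nat.strong_induction_on generalizing u v with
  | _ n ih =>
  rcases u with - | ⟨a, u⟩
  · rw [wordMul]
    exact Submodule.subset_span ⟨v, ⟨by simpa using h, hv⟩, rfl⟩
  rcases v with - | ⟨b, v⟩
  · rw [wordMul]
    exact Submodule.subset_span ⟨a :: u, ⟨by simp, hu⟩, rfl⟩
  rw [wordMul]
  exact ι_mul_mem_end _ (wordMul_inner_mem_end a b u v hu hv
    fun u' v' hlt h1 h2 h3 => ih _ (hn ▸ hlt) u' v' rfl h1 h2 h3)

theorem wordMul_mem_admissible {u v : List outerMonoid} (hu : IsAdmissible u)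
    (hv : IsAdmissible v) : wordMul u v ∈ admissibleSubmodule := by
  rcases u with - | ⟨a, u⟩
  · rw [wordMul]
    exact Submodule.subset_span ⟨v, hv, rfl⟩
  rcases v with - | ⟨b, v⟩
  · rw [wordMul]
    exact Submodule.subset_span ⟨a :: u, hu, rfl⟩
  rw [wordMul]
  have ha : a ≠ 0 := by simpa using hu.1
  have hb : b ≠ 0 := by simpa using hv.1
  exact ι_mul_mem_admissible (outerMonoid_mul_ne_zero ha hb)
    (wordMul_inner_mem_end a b u v hu.2 hv.2
      fun u' v' _ h1 h2 h3 => wordMul_mem_end _ u' v' rfl h1 h2 h3)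

theorem harmonicMul_mem_admissible {x y : FreeAlgebra ℚ outerMonoid}
    (hx : x ∈ admissibleSubmodule) (hy : y ∈ admissibleSubmodule) :
    harmonicMul outerMonoid x y ∈ admissibleSubmodule := by
  refine Submodule.span_le
    (p := admissibleSubmodule.comap ((harmonicMul outerMonoid).flip y)) |>.mpr ?_ hx
  rintro _ ⟨u, hu, rfl⟩
  refine Submodule.span_le
    (p := admissibleSubmodule.comap (harmonicMul outerMonoid (word u))) |>.mpr ?_ hy
  rintro _ ⟨v, hv, rfl⟩
  simp only [Submodule.comap_coe, Set.mem_preimage, SetLike.mem_coe, harmonicMul_word]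
  exact wordMul_mem_admissible hu hv

theorem one_mem_admissible : (1 : FreeAlgebra ℚ outerMonoid) ∈ admissibleSubmodule :=
  Submodule.subset_span ⟨[], by simp [IsAdmissible], word_nil⟩

/-- The subspace spanned by the admissible words, as a `ℚ`-subalgebra of the harmonic algebra. -/
def admissibleSubalgebra : Subalgebra ℚ (HarmonicAlgebra outerMonoid) :=
  (admissibleSubmodule.map (toHarmonic outerMonoid).toLinearMap).toSubalgebra
    ⟨1, one_mem_admissible, rfl⟩
    (by
      rintro _ _ ⟨x, hx, rfl⟩ ⟨y, hy, rfl⟩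
      exact ⟨harmonicMul outerMonoid x y, harmonicMul_mem_admissible hx hy, rfl⟩)

/-- The open simplex `s < t_1 < ⋯ < t_k < u`. -/
def openSimplex (s u : ℝ) (k : ℕ) : Set (Fin k → ℝ) :=
  {t | StrictMono t ∧ ∀ i, s < t i ∧ t i < u}

/-- The integrand `∏_i 1 / (t_i - z_i)` attached to the word `e_{z_1} ⋯ e_{z_k}`. -/
def integrand (w : List outerMonoid) (t : Fin w.length → ℝ) : ℂ :=
  ∏ i, 1 / ((t i : ℂ) - (w.get i : ℂ))

/-- The iterated integral of a word from `s` to `u`. For the empty word this is `1`. -/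
def wordIntegral (s u : ℝ) (w : List outerMonoid) : ℂ :=
  ∫ t in openSimplex s u w.length, integrand w t

/-- The iterated integral `I_{s,u}` as a `ℚ`-linear map on the span of the admissible words.
(It is obtained by restriction of a linear map on all of `ℚ⟨e_z | z ∈ M⟩`, whose values on the
other words are irrelevant.) -/
def iteratedIntegral (s u : ℝ) : admissibleSubalgebra →ₗ[ℚ] ℂ :=
  ((wordBasis outerMonoid).constr ℚ (wordIntegral s u)
    ∘ₗ (toHarmonic outerMonoid).symm.toLinearMap) ∘ₗ admissibleSubalgebra.val.toLinearMap

end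

end HarmonicProduct

namespace HarmonicProduct

open Filter Topology

/-! Weight the iterated integral by `t_1 ^ N`, giving a moment `L_N`. Integrating `t ^ (N+1) - a t ^
N = t ^ N (t - a)` over the innermost variable yields `a L_N(e_a w) = L_{N+1}(e_a w) - L_{N+1}(w) /
(N+1)` (`moment_cons`). Multiplying two such relations and comparing with the recursion for `∗`
shows, by induction on the words, that the defect `D_N = L_N(u ∗ v) - L_N(u) L_N(v)` of words
starting with `a`, `b` satisfies `ab D_N = D_{N+1}` (`defect_succ`).

For `ab ≠ 0` one has `|ab| ≥ 1`, so `|D_N|` is nondecreasing in `N`; it also tends to `0` because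
`t_1 < 1`, hence it vanishes (`eq_zero_of_mul_eq_succ`). For `ab = 0` the relation kills every `D_N`
with `N ≥ 1`. Multiplicativity of `I_{0,1}` is the case `N = 0`. Convergence of all these integrals
is `integrableOn_integrand`. -/

/-! ### Simplices and integration over the innermost variable. -/

/-- The innermost integration variable, understood as the upper limit `1` if there is none. -/
def lead : {k : ℕ} → (Fin k → ℝ) → ℝ
  | 0, _ => 1
  | _ + 1, t => t 0

theorem measurable_lead {k : ℕ} : Measurable (lead : (Fin k → ℝ) → ℝ) := by
  cases k with
  | zero => exact measurable_const
  | succ k => exact measurable_pi_apply 0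

theorem lead_mem {k : ℕ} {t : Fin k → ℝ} (ht : t ∈ openSimplex 0 1 k) :
    0 < lead t ∧ lead t ≤ 1 := by
  cases k with
  | zero => simp [lead]
  | succ k => exact ⟨(ht.2 0).1, (ht.2 0).2.le⟩

theorem measurableSet_openSimplex (s u : ℝ) (k : ℕ) : MeasurableSet (openSimplex s u k) := by
  have : openSimplex s u k =
      (⋂ i, ⋂ j, ⋂ (_ : i < j), {t | t i < t j}) ∩ ⋂ i, {t | s < t i ∧ t i < u} := by
    ext t; simp [openSimplex, StrictMono]
  rw [this]
  refine MeasurableSet.inter ?_ ?_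
  · exact .iInter fun i => .iInter fun j => .iInter fun _ =>
      measurableSet_lt (measurable_pi_apply i) (measurable_pi_apply j)
  · exact .iInter fun i => (measurableSet_lt measurable_const (measurable_pi_apply i)).inter
      (measurableSet_lt (measurable_pi_apply i) measurable_const)

/-- The convention that `lead` is `1` on the empty tuple makes this uniform in `k`. -/
theorem cons_mem_openSimplex {k : ℕ} {s : ℝ} {t : Fin k → ℝ} :
    (Fin.cons s t : Fin (k + 1) → ℝ) ∈ openSimplex 0 1 (k + 1) ↔
      t ∈ openSimplex 0 1 k ∧ s ∈ Set.Ioo 0 (lead t) := by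
  simp only [openSimplex, Set.mem_ofPred_eq, Fin.forall_fin_succ, Fin.cons_zero, Fin.cons_succ,
    Set.mem_Ioo]
  cases k with
  | zero =>
    have : StrictMono (Fin.cons s t : Fin (0 + 1) → ℝ) :=
      Subsingleton.strictMono (α := Fin 1) _
    have h : StrictMono t := Subsingleton.strictMono _
    simp [this, h, lead]
  | succ k =>
    rw [Fin.strictMono_iff_lt_succ, Fin.forall_fin_succ, Fin.strictMono_iff_lt_succ]
    simp only [lead, ← Fin.succ_castSucc, Fin.cons_succ, Fin.castSucc_zero, Fin.cons_zero]
    constructor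
    · rintro ⟨⟨h1, h2⟩, ⟨h3, h4⟩, h5⟩
      exact ⟨⟨h2, h5⟩, h3, h1⟩
    · rintro ⟨⟨h2, h5⟩, h3, h1⟩
      exact ⟨⟨h1, h2⟩, ⟨h3, h1.trans (h5 0).2⟩, h5⟩

theorem integral_pow_Ioo {x : ℝ} (hx : 0 ≤ x) (N : ℕ) :
    ∫ s in Set.Ioo 0 x, (s : ℂ) ^ N = (x : ℂ) ^ (N + 1) / (N + 1) := by
  rw [← integral_Ioc_eq_integral_Ioo, ← intervalIntegral.integral_of_le hx]
  have : ∀ s : ℝ, (s : ℂ) ^ N = ((s ^ N : ℝ) : ℂ) := fun s => by push_cast; rfl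
  simp only [this, intervalIntegral.integral_ofReal, integral_pow]
  push_cast
  simp

/-- Integrating out the innermost variable. -/
theorem setIntegral_openSimplex_succ {k : ℕ} (N : ℕ) (f : (Fin k → ℝ) → ℂ)
    (hf : IntegrableOn (fun t : Fin (k + 1) → ℝ => (t 0 : ℂ) ^ N * f (Fin.tail t))
      (openSimplex 0 1 (k + 1))) :
    ∫ t in openSimplex 0 1 (k + 1), (t 0 : ℂ) ^ N * f (Fin.tail t) =
      (∫ t in openSimplex 0 1 k, (lead t : ℂ) ^ (N + 1) * f t) / (N + 1) := by
  set F : (Fin (k + 1) → ℝ) → ℂ := fun t => (t 0 : ℂ) ^ N * f (Fin.tail t)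
  have hS := measurableSet_openSimplex 0 1 (k + 1)
  have mp := (volume_preserving_piFinSuccAbove (fun _ : Fin (k + 1) => ℝ) 0).symm
  -- The indicator of the simplex factors into that of the lower simplex in `t` and that of `(0,
  -- lead t)` in `s`, the form needed for Fubini.
  have hF : ∀ p : ℝ × (Fin k → ℝ),
      (openSimplex 0 1 (k + 1)).indicator F
        ((MeasurableEquiv.piFinSuccAbove (fun _ : Fin (k + 1) => ℝ) 0).symm p) =
      (openSimplex 0 1 k).indicator
        (fun t => (Set.Ioo 0 (lead t)).indicator (fun s => (s : ℂ) ^ N) p.1 * f t) p.2 := by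
    rintro ⟨s, t⟩
    have e : (MeasurableEquiv.piFinSuccAbove (fun _ : Fin (k + 1) => ℝ) 0).symm (s, t) =
        (Fin.cons s t : Fin (k + 1) → ℝ) := by
      simp [MeasurableEquiv.piFinSuccAbove_symm_apply, Fin.insertNthEquiv]
    rw [e]
    by_cases h1 : t ∈ openSimplex 0 1 k <;> by_cases h2 : s ∈ Set.Ioo 0 (lead t)
    · simp only [Set.indicator_of_mem (cons_mem_openSimplex.2 ⟨h1, h2⟩), Set.indicator_of_mem h1,
        Set.indicator_of_mem h2, F, Fin.cons_zero, Fin.tail_cons]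
    · rw [Set.indicator_of_notMem (fun h => h2 (cons_mem_openSimplex.1 h).2)]
      simp [Set.indicator_of_mem h1, Set.indicator_of_notMem h2]
    all_goals
      rw [Set.indicator_of_notMem (fun h => h1 (cons_mem_openSimplex.1 h).1)]
      simp [Set.indicator_of_notMem h1]
  rw [← integral_indicator hS, ← mp.integral_comp' (g := (openSimplex 0 1 (k + 1)).indicator F)]
  have hi := (mp.integrable_comp_emb (MeasurableEquiv.measurableEmbedding _)).2
    (hf.integrable_indicator hS)
  simp only [Function.comp_def] at hi
  simp only [hF] at hi ⊢
  rw [Measure.volume_eq_prod] at hi ⊢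
  rw [integral_prod_symm _ hi, ← integral_indicator (measurableSet_openSimplex 0 1 k),
    ← integral_div]
  congr 1
  ext t
  by_cases h1 : t ∈ openSimplex 0 1 k
  · simp only [Set.indicator_of_mem h1]
    rw [integral_mul_const, integral_indicator measurableSet_Ioo,
      integral_pow_Ioo (lead_mem h1).1.le]
    ring
  · simp [Set.indicator_of_notMem h1]

/-! ### Absolute convergence. -/

/-- This is the convergence of the Beta integral `B(r, r)`. -/
theorem integrableOn_mul_one_sub_rpow {r : ℝ} (hr : 0 < r) :
    IntegrableOn (fun x : ℝ => (x * (1 - x)) ^ (r - 1)) (Set.Ioo 0 1) := by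
  have h := Complex.betaIntegral_convergent (u := r) (v := r) (by simpa) (by simpa)
  rw [intervalIntegrable_iff_integrableOn_Ioo_of_le zero_le_one] at h
  refine IntegrableOn.congr_fun h.norm (fun x hx => ?_) measurableSet_Ioo
  have h1 : (1 : ℂ) - x = ((1 - x : ℝ) : ℂ) := by push_cast; rfl
  have hx' : 0 < 1 - x := sub_pos.2 hx.2
  simp only [norm_mul, h1, Complex.norm_cpow_eq_rpow_re_of_pos hx.1,
    Complex.norm_cpow_eq_rpow_re_of_pos hx']
  rw [Real.mul_rpow hx.1.le hx'.le]
  simp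

/-- On the cube, a product `P ∏ 1 / (t_i (1 - t_i))` is integrable as soon as
`P ≤ D t_i (1 - t_i)` for all `i`. -/
theorem integrableOn_of_forall_le {k : ℕ} {S : Set (Fin (k + 1) → ℝ)} (hS : MeasurableSet S)
    (hS' : ∀ t ∈ S, ∀ i, t i ∈ Set.Ioo 0 1) {F : (Fin (k + 1) → ℝ) → ℂ} (hF : Measurable F)
    {D : ℝ} (hD : 0 ≤ D)
    (h : ∀ t ∈ S, ∀ i, ‖F t‖ * ∏ j, (t j * (1 - t j)) ≤ D * (t i * (1 - t i))) :
    IntegrableOn F S := by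
  -- Multiplying the `k + 1` bounds and taking the `(k + 1)`-th root gives `‖F‖ ≤ D ∏ (t_i (1 -
  -- t_i)) ^ (r - 1)` with `r = 1 / (k + 1)`, a product of convergent Beta integrands.
  set r : ℝ := ((k + 1 : ℕ) : ℝ)⁻¹
  have hr : 0 < r := by positivity
  have hb : IntegrableOn (fun t : Fin (k + 1) → ℝ => D * ∏ i, (t i * (1 - t i)) ^ (r - 1)) S := by
    have := Integrable.fintype_prod (ι := Fin (k + 1))
      (μ := fun _ => volume.restrict (Set.Ioo (0 : ℝ) 1)) fun _ => integrableOn_mul_one_sub_rpow hr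
    rw [← Measure.restrict_pi_pi] at this
    exact (IntegrableOn.mono_set this fun t ht i _ => hS' t ht i).const_mul D
  refine Integrable.mono' hb hF.aestronglyMeasurable ?_
  filter_upwards [ae_restrict_mem hS] with t ht
  have hpos : ∀ i, 0 < t i * (1 - t i) := fun i =>
    mul_pos (hS' t ht i).1 (sub_pos.2 (hS' t ht i).2)
  have hP : 0 < ∏ j, (t j * (1 - t j)) := Finset.prod_pos fun i _ => hpos i
  set Q := ‖F t‖ * ∏ j, (t j * (1 - t j)) with hQ
  have hQ0 : 0 ≤ Q := by positivity
  have hpow : Q ^ (k + 1) ≤ D ^ (k + 1) * ∏ j, (t j * (1 - t j)) := by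
    calc Q ^ (k + 1) = ∏ _j : Fin (k + 1), Q := by simp
      _ ≤ ∏ j : Fin (k + 1), D * (t j * (1 - t j)) :=
        Finset.prod_le_prod (fun _ _ => hQ0) fun i _ => h t ht i
      _ = _ := by rw [Finset.prod_mul_distrib]; simp
  have hQle : Q ≤ D * (∏ j, (t j * (1 - t j))) ^ r := by
    calc Q = (Q ^ (k + 1)) ^ r := (Real.pow_rpow_inv_natCast hQ0 (by omega)).symm
      _ ≤ (D ^ (k + 1) * ∏ j, (t j * (1 - t j))) ^ r :=
        Real.rpow_le_rpow (by positivity) hpow hr.le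
      _ = _ := by
        rw [Real.mul_rpow (by positivity) hP.le, Real.pow_rpow_inv_natCast hD (by omega)]
  rw [Real.finsetProd_rpow _ _ fun i _ => (hpos i).le, Real.rpow_sub_one hP.ne', ← mul_div_assoc,
    le_div_iff₀ hP]
  exact hQle

/-- A letter of modulus at least `1` other than `1` lies off the compact segment `[0, 1]`, hence at
positive distance from it; for the letter `0` the constant `1` works. -/
theorem exists_le_mul_norm_sub {z : outerMonoid} (hz : z ≠ 1) :
    ∃ C : ℝ, 1 ≤ C ∧ ∀ t ∈ Set.Ioo (0 : ℝ) 1, t ≤ C * ‖(t : ℂ) - z‖ := by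
  rcases z.2 with h | h
  · obtain ⟨x, hx, hmin⟩ := (isCompact_Icc (a := (0 : ℝ)) (b := 1)).exists_isMinOn
      (f := fun t : ℝ => ‖(t : ℂ) - z‖) ⟨0, by simp⟩ (by fun_prop)
    have hpos : 0 < ‖(x : ℂ) - z‖ := by
      rw [norm_pos_iff, sub_ne_zero]
      intro e
      have h1 : (1 : ℝ) ≤ ‖(z : ℂ)‖ := h
      rw [← e, Complex.norm_real, Real.norm_of_nonneg hx.1] at h1
      have : x = 1 := le_antisymm hx.2 h1
      exact hz (Subtype.ext (by rw [← e, this]; simp))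
    refine ⟨max 1 ‖(x : ℂ) - z‖⁻¹, le_max_left _ _, fun t ht => ?_⟩
    have h2 : ‖(x : ℂ) - z‖ ≤ ‖(t : ℂ) - z‖ := hmin (Set.Ioo_subset_Icc_self ht)
    calc t ≤ 1 := ht.2.le
      _ = ‖(x : ℂ) - z‖⁻¹ * ‖(x : ℂ) - z‖ := (inv_mul_cancel₀ hpos.ne').symm
      _ ≤ _ := mul_le_mul (le_max_right _ _) h2 hpos.le (by positivity)
  · refine ⟨1, le_rfl, fun t ht => ?_⟩
    have : (z : ℂ) = 0 := h
    rw [this, sub_zero, Complex.norm_real, Real.norm_of_nonneg ht.1.le, one_mul]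

theorem one_sub_le_norm_sub {z : outerMonoid} (hz : z ≠ 0) {t : ℝ} (ht : t ∈ Set.Ioo (0 : ℝ) 1) :
    1 - t ≤ ‖(t : ℂ) - z‖ := by
  have h : (1 : ℝ) ≤ ‖(z : ℂ)‖ := z.2.resolve_right fun h => hz (Subtype.ext h)
  have h2 := norm_sub_norm_le (z : ℂ) t
  rw [norm_sub_rev, Complex.norm_real, Real.norm_of_nonneg ht.1.le] at h2
  linarith

theorem mul_one_sub_le_norm_sub (z : outerMonoid) {t : ℝ} (ht : t ∈ Set.Ioo (0 : ℝ) 1) :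
    t * (1 - t) ≤ ‖(t : ℂ) - z‖ := by
  have h1 := ht.1
  have h2 := ht.2
  by_cases hz : z = 0
  · subst hz
    rw [coe_zero, sub_zero, Complex.norm_real, Real.norm_of_nonneg ht.1.le]
    nlinarith
  · have := one_sub_le_norm_sub hz ht
    nlinarith

theorem norm_sub_pos (z : outerMonoid) {t : ℝ} (ht : t ∈ Set.Ioo (0 : ℝ) 1) :
    0 < ‖(t : ℂ) - z‖ :=
  (mul_pos ht.1 (sub_pos.2 ht.2)).trans_le (mul_one_sub_le_norm_sub z ht)

theorem measurable_integrand (w : List outerMonoid) : Measurable (integrand w) := by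
  unfold integrand
  fun_prop

/-- After multiplication by `∏ t_j (1 - t_j)` every factor is at most `1`. The first letter, or a
positive power `N`, improves the bound to `t_0`; the last letter improves it to `C (1 - t_last)`. As
`t_0 ≤ t_i ≤ t_last`, both bounds transfer to every `t_i`. -/
theorem integrableOn_integrand (N : ℕ) (w : List outerMonoid) (hlast : w.getLast? ≠ some 1)
    (hfirst : N ≠ 0 ∨ w.head? ≠ some 0) :
    IntegrableOn (fun t => (lead t : ℂ) ^ N * integrand w t) (openSimplex 0 1 w.length) := by
  rcases w with - | ⟨a, w⟩
  · have : (fun t : Fin 0 → ℝ => (lead t : ℂ) ^ N * integrand [] t) = fun _ => 1 := by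
      ext t; simp [lead, integrand]
    change IntegrableOn (fun t : Fin 0 → ℝ => (lead t : ℂ) ^ N * integrand [] t) _
    rw [this]
    exact integrableOn_const (by simp [volume_pi])
  have hmem : ∀ t ∈ openSimplex 0 1 (a :: w).length, ∀ i, t i ∈ Set.Ioo (0 : ℝ) 1 :=
    fun t ht => ht.2
  obtain ⟨C, hC1, hC⟩ := exists_le_mul_norm_sub (z := (a :: w).get (Fin.last w.length)) (by
    intro h
    apply hlast
    rw [List.getLast?_eq_getLast_of_ne_nil (by simp), ← h, List.getLast_eq_getElem]
    simp)
  refine integrableOn_of_forall_le (k := w.length) (D := 2 * C) (measurableSet_openSimplex 0 1 _)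
    hmem (((Complex.measurable_ofReal.comp measurable_lead).pow_const N).mul
      (measurable_integrand _)) (by linarith) fun t ht i => ?_
  set g : Fin (w.length + 1) → ℝ := fun j => t j * (1 - t j) / ‖(t j : ℂ) - (a :: w).get j‖
  have hg0 : ∀ j, 0 ≤ g j := fun j =>
    div_nonneg (mul_nonneg (hmem t ht j).1.le (sub_nonneg.2 (hmem t ht j).2.le)) (norm_nonneg _)
  have hg1 : ∀ j, g j ≤ 1 := fun j =>
    div_le_one_of_le₀ (mul_one_sub_le_norm_sub _ (hmem t ht j)) (norm_nonneg _)
  have hQ : ‖(lead t : ℂ) ^ N * integrand (a :: w) t‖ * ∏ j : Fin (w.length + 1),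
      (t j * (1 - t j)) = t 0 ^ N * ∏ j, g j := by
    have : ‖(lead t : ℂ)‖ = t 0 := by
      rw [Complex.norm_real, Real.norm_of_nonneg (lead_mem ht).1.le]; rfl
    rw [norm_mul, norm_pow, this, integrand, norm_prod, mul_assoc]
    erw [← Finset.prod_mul_distrib]
    congr 1
    refine Finset.prod_congr rfl fun j _ => ?_
    simp only [norm_div, norm_one, g]
    ring
  have ht0 : t 0 ∈ Set.Ioo (0 : ℝ) 1 := hmem t ht 0
  have hfirst' : t 0 ^ N * ∏ j, g j ≤ t 0 := by
    have h0 : t 0 ^ N * g 0 ≤ t 0 := by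
      by_cases hN : N = 0
      · have ha : a ≠ 0 := by simpa [hN] using hfirst
        have h2 := one_sub_le_norm_sub ha ht0
        subst hN
        rw [pow_zero, one_mul, div_le_iff₀ (norm_sub_pos _ ht0)]
        exact mul_le_mul_of_nonneg_left h2 ht0.1.le
      · calc t 0 ^ N * g 0 ≤ t 0 * 1 := mul_le_mul
              (pow_le_of_le_one ht0.1.le ht0.2.le hN) (hg1 0) (hg0 0) ht0.1.le
          _ = t 0 := mul_one _
    rw [Fin.prod_univ_succ, ← mul_assoc]
    exact (mul_le_of_le_one_right (mul_nonneg (pow_nonneg ht0.1.le _) (hg0 0))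
      (Finset.prod_le_one (fun j _ => hg0 _) fun j _ => hg1 _)).trans h0
  have hlast' : t 0 ^ N * ∏ j, g j ≤ C * (1 - t (Fin.last w.length)) := by
    have htl := hmem t ht (Fin.last w.length)
    have hl : g (Fin.last w.length) ≤ C * (1 - t (Fin.last w.length)) := by
      rw [div_le_iff₀ (norm_sub_pos _ htl)]
      nlinarith [hC _ htl, sub_pos.2 htl.2]
    rw [Fin.prod_univ_castSucc]
    calc _ ≤ 1 * (1 * g (Fin.last w.length)) := by
          refine mul_le_mul (pow_le_one₀ ht0.1.le ht0.2.le) ?_ ?_ zero_le_one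
          · exact mul_le_mul_of_nonneg_right
              (Finset.prod_le_one (fun j _ => hg0 _) fun j _ => hg1 _) (hg0 _)
          · exact mul_nonneg (Finset.prod_nonneg fun j _ => hg0 _) (hg0 _)
      _ ≤ _ := by simpa using hl
  erw [hQ]
  have hti := hmem t ht i
  have hle0 : t 0 ≤ t i := ht.1.monotone (Fin.zero_le (n := w.length + 1) i)
  have hlel : t i ≤ t (Fin.last w.length) := ht.1.monotone (Fin.le_last (n := w.length) i)
  have h1 : t 0 ^ N * ∏ j, g j ≤ t i := hfirst'.trans hle0
  have h2 : t 0 ^ N * ∏ j, g j ≤ C * (1 - t i) :=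
    hlast'.trans (mul_le_mul_of_nonneg_left (by linarith) (by linarith))
  have h3 : 0 < 1 - t i := sub_pos.2 hti.2
  have h4 := hti.1
  -- One of `t_i`, `1 - t_i` is at least `1/2`, which accounts for the factor `2` in `D = 2 * C`.
  rcases le_total (t i) (1 / 2) with h | h
  · refine h1.trans ?_
    have : 1 ≤ C * (2 * (1 - t i)) := one_le_mul_of_one_le_of_one_le hC1 (by linarith)
    nlinarith
  · refine h2.trans ?_
    have : 0 ≤ C * (1 - t i) := by positivity
    nlinarith

/-! ### Moments: recursion and decay. -/

/-- The iterated integral of a word from `0` to `1`, weighted by the `N`-th power of the innermost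
variable. -/
noncomputable def moment (N : ℕ) (w : List outerMonoid) : ℂ :=
  ∫ t in openSimplex 0 1 w.length, (lead t : ℂ) ^ N * integrand w t

theorem moment_zero (w : List outerMonoid) : moment 0 w = wordIntegral 0 1 w := by
  simp [moment, wordIntegral]

theorem moment_nil (N : ℕ) : moment N [] = 1 := by
  have h : openSimplex 0 1 0 = Set.univ :=
    Set.eq_univ_of_forall fun t => ⟨Subsingleton.strictMono _, fun i => i.elim0⟩
  change ∫ t in openSimplex 0 1 0, (lead t : ℂ) ^ N * integrand [] t = 1
  rw [h, Measure.restrict_univ]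
  simp [lead, integrand, volume_pi, measureReal_def]

theorem integrand_cons (a : outerMonoid) (w : List outerMonoid) (t : Fin (w.length + 1) → ℝ) :
    integrand (a :: w) t = 1 / ((t 0 : ℂ) - a) * integrand w (Fin.tail t) := by
  unfold integrand
  exact Fin.prod_univ_succ _

theorem moment_cons (N : ℕ) {a : outerMonoid} {w : List outerMonoid}
    (h : (a :: w).getLast? ≠ some 1) :
    (a : ℂ) * moment N (a :: w) = moment (N + 1) (a :: w) - moment (N + 1) w / (N + 1) := by
  have hI1 := integrableOn_integrand (N + 1) (a :: w) h (Or.inl (Nat.succ_ne_zero N))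
  have hI0 : IntegrableOn (fun t => (a : ℂ) * ((lead t : ℂ) ^ N * integrand (a :: w) t))
      (openSimplex 0 1 (a :: w).length) := by
    -- For `a = 0` the `N`-th moment may diverge when `N = 0`, but its coefficient is then zero.
    by_cases ha : a = 0
    · subst ha
      simp only [coe_zero, zero_mul]
      exact integrableOn_zero
    · exact (integrableOn_integrand N (a :: w) h (Or.inr (by simpa using ha))).const_mul _
  have key : ∀ t ∈ openSimplex 0 1 (w.length + 1),
      (lead t : ℂ) ^ (N + 1) * integrand (a :: w) t -
        (a : ℂ) * ((lead t : ℂ) ^ N * integrand (a :: w) t) =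
      (t 0 : ℂ) ^ N * integrand w (Fin.tail t) := by
    intro t ht
    have h0 := norm_pos_iff.1 (norm_sub_pos a (ht.2 0))
    rw [integrand_cons]
    simp only [lead]
    field_simp
    ring
  have hS := measurableSet_openSimplex 0 1 (w.length + 1)
  -- The integrability required by Fubini comes from the difference of two integrable functions,
  -- with no separate estimate.
  have hI := IntegrableOn.congr_fun (hI1.sub hI0) key hS
  have hF := setIntegral_openSimplex_succ N (integrand w) hI
  rw [← setIntegral_congr_fun hS key] at hF
  have hsub := integral_sub hI1 hI0
  rw [integral_const_mul] at hsub
  have : moment (N + 1) (a :: w) - a * moment N (a :: w) = moment (N + 1) w / (N + 1) :=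
    hsub.symm.trans hF
  linear_combination -this

theorem tendsto_moment {w : List outerMonoid} (hw : w ≠ []) (h : w.getLast? ≠ some 1) :
    Tendsto (fun N => moment N w) atTop (𝓝 0) := by
  obtain ⟨a, w, rfl⟩ := List.exists_cons_of_ne_nil hw
  -- The sequence starts at `N = 1`, whose integrand serves as dominating function: at `N = 0` a
  -- first letter `0` could spoil integrability.
  rw [← tendsto_add_atTop_iff_nat 1]
  have hI := fun N => integrableOn_integrand (N + 1) (a :: w) h (Or.inl (Nat.succ_ne_zero N))
  have hS := measurableSet_openSimplex 0 1 (a :: w).length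
  have := tendsto_integral_of_dominated_convergence _
    (fun N => (hI N).aestronglyMeasurable) (hI 0).norm (f := fun _ => 0) (fun N => by
      filter_upwards [ae_restrict_mem hS] with t ht
      rw [norm_mul, norm_mul, norm_pow, norm_pow]
      refine mul_le_mul_of_nonneg_right ?_ (norm_nonneg _)
      rw [Complex.norm_real, Real.norm_of_nonneg (lead_mem ht).1.le]
      exact pow_le_pow_of_le_one (lead_mem ht).1.le (lead_mem ht).2 (by omega)) (by
      filter_upwards [ae_restrict_mem hS] with t ht
      rw [← zero_mul (integrand (a :: w) t)]
      refine Tendsto.mul_const _ ?_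
      rw [tendsto_add_atTop_iff_nat (f := fun n => (lead t : ℂ) ^ n) 1]
      apply tendsto_pow_atTop_nhds_zero_of_norm_lt_one
      rw [Complex.norm_real, Real.norm_of_nonneg (lead_mem ht).1.le]
      exact (ht.2 (0 : Fin (w.length + 1))).2)
  simpa [moment] using this

/-! ### Linear extension of the moments. -/

/-- The `ℚ`-linear extension of `moment N`. -/
noncomputable def momentMap (N : ℕ) : FreeAlgebra ℚ outerMonoid →ₗ[ℚ] ℂ :=
  (wordBasis outerMonoid).constr ℚ (moment N)

theorem momentMap_word (N : ℕ) (w : List outerMonoid) : momentMap N (word w) = moment N w := by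
  rw [← wordBasis_apply w]
  simp only [momentMap, Module.Basis.constr_basis]

/-- The span contains the empty word when `a ≠ 1`, unlike `endSubmodule`; this is needed for `e_0 (1
∗ 1)`. -/
theorem momentMap_ι_mul (N : ℕ) (a : outerMonoid) {x : FreeAlgebra ℚ outerMonoid}
    (hx : x ∈ Submodule.span ℚ (word '' {w | (a :: w).getLast? ≠ some 1})) :
    (a : ℂ) * momentMap N (FreeAlgebra.ι ℚ a * x) =
      momentMap (N + 1) (FreeAlgebra.ι ℚ a * x) - momentMap (N + 1) x / (N + 1) := by
  induction hx using Submodule.span_induction with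
  | mem x h =>
    obtain ⟨w, hw, rfl⟩ := h
    simp only [← word_cons, momentMap_word]
    exact moment_cons N hw
  | zero => simp
  | add x y _ _ h1 h2 =>
    simp only [mul_add, map_add]
    linear_combination h1 + h2
  | smul c x _ h =>
    simp only [mul_smul_comm, map_smul, Rat.smul_def]
    linear_combination (c : ℂ) * h

theorem endSubmodule_le (a : outerMonoid) :
    endSubmodule ≤ Submodule.span ℚ (word '' {w | (a :: w).getLast? ≠ some 1}) := by
  refine Submodule.span_mono (Set.image_mono ?_)
  rintro w ⟨h1, h2⟩
  obtain ⟨b, w, rfl⟩ := List.exists_cons_of_ne_nil h1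
  simpa using h2

theorem tendsto_momentMap {x : FreeAlgebra ℚ outerMonoid} (hx : x ∈ endSubmodule) :
    Tendsto (fun N => momentMap N x) atTop (𝓝 0) := by
  induction hx using Submodule.span_induction with
  | mem x h =>
    obtain ⟨w, ⟨h1, h2⟩, rfl⟩ := h
    simpa only [momentMap_word] using tendsto_moment h1 h2
  | zero => simp
  | add x y _ _ h1 h2 => simpa using h1.add h2
  | smul c x _ h => simpa [Rat.smul_def] using h.const_mul (c : ℂ)

/-- The recursion with `a = 0`, whose left side vanishes. It evaluates the correction term `- e_0 (w
∗ w')` of the harmonic product. -/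
theorem momentMap_ι_zero_mul_wordMul (N : ℕ) {u v : List outerMonoid}
    (hu : u.getLast? ≠ some 1) (hv : v.getLast? ≠ some 1) :
    momentMap (N + 1) (FreeAlgebra.ι ℚ 0 * wordMul u v) =
      momentMap (N + 1) (wordMul u v) / (N + 1) := by
  have hx : wordMul u v ∈
      Submodule.span ℚ (word '' {w | ((0 : outerMonoid) :: w).getLast? ≠ some 1}) := by
    by_cases h : u ≠ [] ∨ v ≠ []
    · exact endSubmodule_le 0 (wordMul_mem_end _ u v rfl hu hv h)
    · simp only [ne_eq, not_or, not_not] at h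
      obtain ⟨rfl, rfl⟩ := h
      exact Submodule.subset_span ⟨[], by simpa using outerMonoid_zero_ne_one, by rw [wordMul]⟩
  have := momentMap_ι_mul N 0 hx
  rw [coe_zero, zero_mul] at this
  exact (sub_eq_zero.1 this.symm)

/-! ### Vanishing of the defect. -/

/-- The failure of multiplicativity of the `N`-th moment on two words. -/
noncomputable def defect (N : ℕ) (u v : List outerMonoid) : ℂ :=
  momentMap N (wordMul u v) - moment N u * moment N v

theorem defect_succ {a b : outerMonoid} {u v : List outerMonoid}
    (hu : (a :: u).getLast? ≠ some 1) (hv : (b :: v).getLast? ≠ some 1) (N : ℕ)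
    (h1 : defect (N + 1) u (b :: v) = 0) (h2 : defect (N + 1) (a :: u) v = 0)
    (h3 : defect (N + 1) u v = 0) :
    (a * b : ℂ) * defect N (a :: u) (b :: v) = defect (N + 1) (a :: u) (b :: v) := by
  have hend := wordMul_inner_mem_end a b u v hu hv
    fun u' v' _ h1 h2 h3 => wordMul_mem_end _ u' v' rfl h1 h2 h3
  have hQ := momentMap_ι_mul N (a * b) (endSubmodule_le _ hend)
  have h0 := momentMap_ι_zero_mul_wordMul N (getLast?_tail_ne hu) (getLast?_tail_ne hv)
  have hA := moment_cons N hu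
  have hB := moment_cons N hv
  rw [map_sub, map_add, h0] at hQ
  unfold defect at *
  rw [wordMul]
  have hab : ((a * b : outerMonoid) : ℂ) = a * b := rfl
  rw [hab] at hQ
  rw [mul_sub, hQ, sub_eq_zero.1 h1, sub_eq_zero.1 h2, sub_eq_zero.1 h3]
  -- Multiplying the recursions for `a u` and `b v` produces a cross term `L_{N+1}(u) L_{N+1}(v) /
  -- (N+1) ^ 2`, matched by the `e_0` term of the harmonic product.
  linear_combination (-(b : ℂ) * moment N (b :: v)) * hA -
    (moment (N + 1) (a :: u) - moment (N + 1) u / (N + 1)) * hB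

/-- The lower bound on the modulus is decisive here: multiplication by a nonzero `z` cannot shrink
the terms, yet they tend to zero. -/
theorem eq_zero_of_mul_eq_succ {z : outerMonoid} {d : ℕ → ℂ}
    (hd : ∀ N, (z : ℂ) * d N = d (N + 1)) (hlim : Tendsto d atTop (𝓝 0)) {N : ℕ}
    (hN : N ≠ 0 ∨ z ≠ 0) : d N = 0 := by
  by_cases hz : z = 0
  · obtain ⟨n, rfl⟩ := Nat.exists_eq_succ_of_ne_zero (hN.resolve_right (not_not.2 hz))
    rw [Nat.succ_eq_add_one, ← hd, hz, coe_zero, zero_mul]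
  · have h : (1 : ℝ) ≤ ‖(z : ℂ)‖ := z.2.resolve_right fun h => hz (Subtype.ext h)
    have hmono : Monotone fun n => ‖d n‖ := monotone_nat_of_le_succ fun n => by
      rw [← hd, norm_mul]
      exact le_mul_of_one_le_left (norm_nonneg _) h
    have := hmono.ge_of_tendsto (by simpa using hlim.norm) N
    exact norm_le_zero_iff.1 this

theorem tendsto_defect {a b : outerMonoid} {u v : List outerMonoid}
    (hu : (a :: u).getLast? ≠ some 1) (hv : (b :: v).getLast? ≠ some 1) :
    Tendsto (fun N => defect N (a :: u) (b :: v)) atTop (𝓝 0) := by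
  have h := (tendsto_momentMap (wordMul_mem_end _ (a :: u) (b :: v) rfl hu hv (by simp))).sub
    ((tendsto_moment (by simp) hu).mul (tendsto_moment (by simp) hv))
  simpa [defect] using h

/-- A positive `N` makes any first letter harmless, so the induction can pass to tails, which need
not be admissible. -/
theorem defect_eq_zero_of_ne_zero (u v : List outerMonoid) (hu : u.getLast? ≠ some 1)
    (hv : v.getLast? ≠ some 1) {N : ℕ} (hN : N ≠ 0) : defect N u v = 0 := by
  induction u, v using wordMul.induct generalizing N with
  | case1 v => simp [defect, wordMul, momentMap_word, moment_nil]
  | case2 a u => simp [defect, wordMul, momentMap_word, moment_nil]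
  | case3 a u b v h1 h2 h3 =>
    have hu' := getLast?_tail_ne hu
    have hv' := getLast?_tail_ne hv
    exact eq_zero_of_mul_eq_succ (z := a * b) (fun n => defect_succ hu hv n
      (h1 hu' hv n.succ_ne_zero) (h2 hu hv' n.succ_ne_zero) (h3 hu' hv' n.succ_ne_zero))
      (tendsto_defect hu hv) (Or.inl hN)

/-- The tails enter only at index `n + 1`, where the defect is already known to vanish;
admissibility gives `ab ≠ 0`, which covers the remaining index `0`. -/
theorem defect_zero {u v : List outerMonoid} (hu : IsAdmissible u) (hv : IsAdmissible v) :
    defect 0 u v = 0 := by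
  rcases u with - | ⟨a, u⟩
  · simp [defect, wordMul, momentMap_word, moment_nil]
  rcases v with - | ⟨b, v⟩
  · simp [defect, wordMul, momentMap_word, moment_nil]
  have ha : a ≠ 0 := by simpa using hu.1
  have hb : b ≠ 0 := by simpa using hv.1
  have hu' := getLast?_tail_ne hu.2
  have hv' := getLast?_tail_ne hv.2
  exact eq_zero_of_mul_eq_succ (z := a * b) (fun n => defect_succ hu.2 hv.2 n
    (defect_eq_zero_of_ne_zero _ _ hu' hv.2 n.succ_ne_zero)
    (defect_eq_zero_of_ne_zero _ _ hu.2 hv' n.succ_ne_zero)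
    (defect_eq_zero_of_ne_zero _ _ hu' hv' n.succ_ne_zero))
    (tendsto_defect hu.2 hv.2) (Or.inr (outerMonoid_mul_ne_zero ha hb))

/-! ### From words to the algebra homomorphism. -/

theorem momentMap_zero_harmonicMul {x y : FreeAlgebra ℚ outerMonoid}
    (hx : x ∈ admissibleSubmodule) (hy : y ∈ admissibleSubmodule) :
    momentMap 0 (harmonicMul outerMonoid x y) = momentMap 0 x * momentMap 0 y := by
  induction hx using Submodule.span_induction with
  | zero => simp
  | add x z _ _ h1 h2 => simp [h1, h2, add_mul]
  | smul c x _ h => simp [h]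
  | mem x hx =>
    obtain ⟨u, hu, rfl⟩ := hx
    induction hy using Submodule.span_induction with
    | zero => simp
    | add x z _ _ h1 h2 => simp [h1, h2, mul_add]
    | smul c x _ h => simp [h]
    | mem y hy =>
      obtain ⟨v, hv, rfl⟩ := hy
      rw [harmonicMul_word, momentMap_word, momentMap_word]
      exact sub_eq_zero.1 (defect_zero hu hv)

theorem iteratedIntegral_apply (x : admissibleSubalgebra) :
    iteratedIntegral 0 1 x = momentMap 0 ((toHarmonic outerMonoid).symm x) := by
  have : moment 0 = wordIntegral 0 1 := funext moment_zero
  simp [iteratedIntegral, momentMap, this]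

theorem symm_mem_admissible (x : admissibleSubalgebra) :
    (toHarmonic outerMonoid).symm x ∈ admissibleSubmodule := by
  obtain ⟨_, y, hy, rfl⟩ := x
  exact hy

end HarmonicProduct

open HarmonicProduct in
theorem theorem5p2 :
    (∀ w : List outerMonoid, IsAdmissible w →
      MeasureTheory.IntegrableOn (integrand w) (openSimplex 0 1 w.length)) ∧
    ∃ φ : admissibleSubalgebra →ₐ[ℚ] ℂ, φ.toLinearMap = iteratedIntegral 0 1 := by
  refine ⟨fun w hw => by simpa using integrableOn_integrand 0 w hw.2 (Or.inr hw.1),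
    AlgHom.ofLinearMap (iteratedIntegral 0 1) ?_ fun x y => ?_, rfl⟩
  · rw [iteratedIntegral_apply]
    exact (congrArg (momentMap 0) word_nil.symm).trans
      ((momentMap_word 0 []).trans (moment_nil 0))
  · simp only [iteratedIntegral_apply]
    exact momentMap_zero_harmonicMul (symm_mem_admissible x) (symm_mem_admissible y)
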